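/- Let $n\ge 1$ and $c$ be natural numbers, let $b_l,b_u,\delta\in\mathbb R$ with $\delta>0$, and let $$\Omega=\{X\in\mathbb R^{n\times c}\mid X1_c=1_n,\ b_l1_c\le X^{\top}1_n\le b_u1_c,\ X\ge 0\}$$ be non-empty, where $1_m\in\mathbb R^m$ is the all-ones vector. Let $\nabla\mathcal H\in\mathbb R^{n\times c}$ be any matrix (for instance the gradient of a function $\mathcal H$ at some point), let $\langle A,X\rangle=\sum_{i,j}A_{ij}X_{ij}$, let $\mathcal G(X)=-\sum_{i,j}X_{ij}\log X_{ij}$ (with $0\log 0=0$), and let $K=e^{-\nabla\mathcal H/\delta}$ be the entrywise exponential, $K_{ij}=e^{-\nabla\mathcal H_{ij}/\delta}$. Then the entropy-regularized problem $$\min_{X\in\Omega}\ \langle\nabla\mathcal H,X\rangle-\delta\,\mathcal G(X)$$ has exactly one optimal solution $X^*$. Moreover, for all starting vectors $v^{(0)},w^{(0)}\in\mathbb R^c$ with positive entries, the iteration (with $\odot$ the entrywise product and with $./$, $\max$, $\min$ taken entrywise) $$u^{(k+1)}=1_n./\bigl(K(v^{(k)}\odot w^{(k)})\bigr),\quad v^{(k+1)}=\max\bigl(b_l1_c./((K^{\top}u^{(k+1)})\odot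 w^{(k)}),\,1_c\bigr),\quad w^{(k+1)}=\min\bigl(b_u1_c./((K^{\top}u^{(k+1)})\odot v^{(k+1)}),\,1_c\bigr)$$ converges: $u^{(k)}\to u^*\in\mathbb R^n$, $v^{(k)}\to v^*\in\mathbb R^c$, $w^{(k)}\to w^*\in\mathbb R^c$ as $k\to\infty$. The limits satisfy $$X^*=\operatorname{diag}(u^*)\,e^{-\nabla\mathcal H/\delta}\,\operatorname{diag}(v^*\odot w^*),$$ $u^*>0$, $v^*\ge 1_c$ and $0<w^*\le 1_c$ entrywise. In addition, for every $j$, if $v^*_j>1$ then the $j$-th column sum of $X^*$ equals $b_l$, and if $w^*_j<1$ then it equals $b_u$. -/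

import Mathlib

open Filter Topology
open scoped Matrix

noncomputable section

namespace DualBoundedOT

/-- The dual-bounded constraint set `Ω`: nonnegative `n × c` matrices with all row sums equal
to `1` and all column sums in `[bl, bu]`. -/
def Omega (n c : ℕ) (bl bu : ℝ) : Set (Matrix (Fin n) (Fin c) ℝ) :=
  {X | (∀ i, ∑ j, X i j = 1) ∧ (∀ j, bl ≤ ∑ i, X i j ∧ ∑ i, X i j ≤ bu) ∧ ∀ i j, 0 ≤ X i j}

/-- The Frobenius inner product `⟨A, X⟩`. -/
def frobInner {n c : ℕ} (A X : Matrix (Fin n) (Fin c) ℝ) : ℝ :=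
  ∑ i, ∑ j, A i j * X i j

/-- The entropy `G(X) = -∑ X i j * log (X i j)`, with the usual convention `0 * log 0 = 0`. -/
def entropy {n c : ℕ} (X : Matrix (Fin n) (Fin c) ℝ) : ℝ :=
  -∑ i, ∑ j, X i j * Real.log (X i j)

/-- The entropy-regularized linear objective `⟨D, X⟩ - δ * G(X)`. -/
def regObjective {n c : ℕ} (D : Matrix (Fin n) (Fin c) ℝ) (δ : ℝ)
    (X : Matrix (Fin n) (Fin c) ℝ) : ℝ :=
  frobInner D X - δ * entropy X

/-- `X` is an optimal solution of `min_{X ∈ Ω} ⟨D, X⟩ - δ * G(X)`. -/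
def IsOptimal {n c : ℕ} (bl bu : ℝ) (D : Matrix (Fin n) (Fin c) ℝ) (δ : ℝ)
    (X : Matrix (Fin n) (Fin c) ℝ) : Prop :=
  X ∈ Omega n c bl bu ∧ IsMinOn (regObjective D δ) (Omega n c bl bu) X

/-- The entrywise exponential `exp(-D / δ)`. -/
def gibbsKernel {n c : ℕ} (D : Matrix (Fin n) (Fin c) ℝ) (δ : ℝ) :
    Matrix (Fin n) (Fin c) ℝ :=
  Matrix.of fun i j => Real.exp (-D i j / δ)

/-- The matrix `diag(u) K diag(v ⊙ w)`. -/
def scaled {n c : ℕ} (K : Matrix (Fin n) (Fin c) ℝ) (u : Fin n → ℝ) (v w : Fin c → ℝ) :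
    Matrix (Fin n) (Fin c) ℝ :=
  Matrix.diagonal u * K * Matrix.diagonal (v * w)

/-- A triple of vectors `(u, v, w)`, the state of the iteration. -/
@[ext]
structure ScalingState (n c : ℕ) where
  u : Fin n → ℝ
  v : Fin c → ℝ
  w : Fin c → ℝ

/-- `u ← 1 ./ (K (v ⊙ w))`. -/
def updateU {n c : ℕ} (K : Matrix (Fin n) (Fin c) ℝ) (v w : Fin c → ℝ) : Fin n → ℝ :=
  fun i => 1 / (K *ᵥ (v * w)) i

/-- `v ← max (bl ./ ((Kᵀ u) ⊙ w), 1)`. -/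
def updateV {n c : ℕ} (K : Matrix (Fin n) (Fin c) ℝ) (bl : ℝ) (u : Fin n → ℝ)
    (w : Fin c → ℝ) : Fin c → ℝ :=
  fun j => max (bl / ((Kᵀ *ᵥ u) j * w j)) 1

/-- `w ← min (bu ./ ((Kᵀ u) ⊙ v), 1)`. -/
def updateW {n c : ℕ} (K : Matrix (Fin n) (Fin c) ℝ) (bu : ℝ) (u : Fin n → ℝ)
    (v : Fin c → ℝ) : Fin c → ℝ :=
  fun j => min (bu / ((Kᵀ *ᵥ u) j * v j)) 1

/-- One sweep of the iteration: `u` is updated from the old `v, w`, then `v` from the new `u`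
and the old `w`, then `w` from the new `u` and the new `v`. -/
def sweep {n c : ℕ} (K : Matrix (Fin n) (Fin c) ℝ) (bl bu : ℝ) (s : ScalingState n c) :
    ScalingState n c :=
  let u' := updateU K s.v s.w
  let v' := updateV K bl u' s.w
  let w' := updateW K bu u' v'
  ⟨u', v', w'⟩

/-- The state after `k` sweeps from the starting state `s₀`. -/
def iter {n c : ℕ} (K : Matrix (Fin n) (Fin c) ℝ) (bl bu : ℝ) (s₀ : ScalingState n c)
    (k : ℕ) : ScalingState n c :=
  (sweep K bl bu)^[k] s₀

end DualBoundedOT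

end

namespace DualBoundedOT

/-! ### Optimality of scaled kernels -/

/-! Write `X = diag(u) K diag(v ⊙ w)`. On matrices with unit row sums, the objective is `δ` times a
relative entropy to `X`, plus terms linear in the column sums with coefficients `log v ≥ 0` and `log
w ≤ 0`. If `X` is feasible and attains `bl` where `v > 1` and `bu` where `w < 1`, Gibbs' inequality
makes it the strict minimizer (`regObjective_lt_of_scaled`). Fixed points of the sweep have these
properties (`kkt_of_sweep_eq`), so convergence of the iteration to a fixed point gives existence and
uniqueness as well.

Convergence is studied through `z = v ⊙ w`. Put `a = Kᵀ(1 ./ (K z))`. Where the new `v` or the old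
`w` is `1`, or where `bl = bu`, the next `z` is the number `1` clipped to `[bl / a, bu / a]`, which
depends on `z` only. This map `reducedStep` is nonexpansive for Thompson's metric, the logarithm of
the least `t` with `x ≤ t y` and `y ≤ t x`. Three facts then give a limit: orbits are trapped
between multiples of a balanced scaling (`exists_bounds_reducedStep`); successive iterates become
close, because each sweep raises a bounded dual objective (`dualObjective_sweep`,
`dualObjective_le`); and a cluster point is therefore fixed, so the distance to it cannot increase
(`exists_tendsto_of_thompson_nonexpansive`).

Finally `v` and `w` are recovered from `z` (`exists_tendsto_v_w`). If `bl < bu`, eventually one of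
them is `1` in each column; if `bl = bu`, `w` is monotone. -/

lemma sub_lt_mul_log_sub {x y : ℝ} (hx : 0 < x) (hy : 0 ≤ y) (h : y ≠ x) :
    y - x < y * (Real.log y - Real.log x) := by
  rcases hy.eq_or_lt with rfl | hy
  · simpa using hx
  · have h1 : x / y ≠ 1 := by
      rw [Ne, div_eq_one_iff_eq hy.ne']
      exact h.symm
    have h2 := Real.log_lt_sub_one_of_pos (div_pos hx hy) h1
    rw [Real.log_div hx.ne' hy.ne'] at h2
    have h3 := mul_lt_mul_of_pos_left h2 hy
    have h4 : y * (x / y - 1) = x - y := by field_simp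
    linarith

lemma sub_le_mul_log_sub {x y : ℝ} (hx : 0 < x) (hy : 0 ≤ y) :
    y - x ≤ y * (Real.log y - Real.log x) := by
  rcases eq_or_ne y x with rfl | h
  · simp
  · exact (sub_lt_mul_log_sub hx hy h).le

lemma scaled_apply {n c : ℕ} (K : Matrix (Fin n) (Fin c) ℝ) (u : Fin n → ℝ) (v w : Fin c → ℝ)
    (i : Fin n) (j : Fin c) : scaled K u v w i j = u i * K i j * (v j * w j) := by
  simp [scaled, Matrix.mul_diagonal, Matrix.diagonal_mul]

lemma sum_scaled_row {n c : ℕ} (K : Matrix (Fin n) (Fin c) ℝ) (u : Fin n → ℝ)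
    (v w : Fin c → ℝ) (i : Fin n) :
    ∑ j, scaled K u v w i j = u i * (K *ᵥ (v * w)) i := by
  simp only [scaled_apply, Matrix.mulVec, dotProduct, Finset.mul_sum, Pi.mul_apply, mul_assoc]

lemma sum_scaled_col {n c : ℕ} (K : Matrix (Fin n) (Fin c) ℝ) (u : Fin n → ℝ)
    (v w : Fin c → ℝ) (j : Fin c) :
    ∑ i, scaled K u v w i j = (Kᵀ *ᵥ u) j * (v j * w j) := by
  simp only [scaled_apply, Matrix.mulVec, dotProduct, Finset.sum_mul, Matrix.transpose_apply]
  exact Finset.sum_congr rfl fun i _ => by ring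

lemma gibbsKernel_pos {n c : ℕ} (D : Matrix (Fin n) (Fin c) ℝ) (δ : ℝ) (i : Fin n)
    (j : Fin c) : 0 < gibbsKernel D δ i j := Real.exp_pos _

/-- The logarithm of the scaled kernel is `log u - D / δ + log v + log w`, which trades `D` for the
scalings. Unit row sums make the `u` term independent of `Y`. -/
lemma regObjective_eq {n c : ℕ} (D : Matrix (Fin n) (Fin c) ℝ) {δ : ℝ} (hδ : 0 < δ)
    {u : Fin n → ℝ} {v w : Fin c → ℝ} (hu : ∀ i, 0 < u i) (hv : ∀ j, 0 < v j)
    (hw : ∀ j, 0 < w j) (Y : Matrix (Fin n) (Fin c) ℝ) (hY : ∀ i, ∑ j, Y i j = 1) :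
    regObjective D δ Y =
      δ * (∑ i, ∑ j, Y i j * (Real.log (Y i j) - Real.log (scaled (gibbsKernel D δ) u v w i j))
        + ∑ i, Real.log (u i) + ∑ j, (Real.log (v j) + Real.log (w j)) * ∑ i, Y i j) := by
  have hlog : ∀ i j, Real.log (scaled (gibbsKernel D δ) u v w i j) =
      Real.log (u i) + (-D i j / δ) + (Real.log (v j) + Real.log (w j)) := by
    intro i j
    rw [scaled_apply, Real.log_mul (mul_pos (hu i) (gibbsKernel_pos D δ i j)).ne'
      (mul_pos (hv j) (hw j)).ne', Real.log_mul (hu i).ne' (gibbsKernel_pos D δ i j).ne',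
      Real.log_mul (hv j).ne' (hw j).ne']
    simp [gibbsKernel]
  have h1 : ∑ i, Real.log (u i) = ∑ i, ∑ j, Y i j * Real.log (u i) := by
    refine Finset.sum_congr rfl fun i _ => ?_
    rw [← Finset.sum_mul, hY, one_mul]
  have h2 : ∑ j, (Real.log (v j) + Real.log (w j)) * ∑ i, Y i j =
      ∑ i, ∑ j, Y i j * (Real.log (v j) + Real.log (w j)) := by
    rw [Finset.sum_comm]
    refine Finset.sum_congr rfl fun j _ => ?_
    rw [← Finset.sum_mul, mul_comm]
  rw [h1, h2, regObjective, frobInner, entropy, mul_neg, sub_neg_eq_add]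
  simp only [hlog, ← Finset.sum_add_distrib, Finset.mul_sum]
  refine Finset.sum_congr rfl fun i _ => Finset.sum_congr rfl fun j _ => ?_
  field_simp
  ring

lemma regObjective_lt_of_scaled {n c : ℕ} {bl bu : ℝ} (D : Matrix (Fin n) (Fin c) ℝ) {δ : ℝ}
    (hδ : 0 < δ) {u : Fin n → ℝ} {v w : Fin c → ℝ} (hu : ∀ i, 0 < u i) (hv : ∀ j, 1 ≤ v j)
    (hw : ∀ j, 0 < w j ∧ w j ≤ 1) {X : Matrix (Fin n) (Fin c) ℝ}
    (hX : X = scaled (gibbsKernel D δ) u v w) (hXΩ : X ∈ Omega n c bl bu)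
    (hbl : ∀ j, 1 < v j → ∑ i, X i j = bl) (hbu : ∀ j, w j < 1 → ∑ i, X i j = bu)
    {Y : Matrix (Fin n) (Fin c) ℝ} (hY : Y ∈ Omega n c bl bu) (hne : Y ≠ X) :
    regObjective D δ X < regObjective D δ Y := by
  have hv0 : ∀ j, 0 < v j := fun j => one_pos.trans_le (hv j)
  have hXpos : ∀ i j, 0 < X i j := fun i j => by
    rw [hX, scaled_apply]
    exact mul_pos (mul_pos (hu i) (gibbsKernel_pos D δ i j)) (mul_pos (hv0 j) (hw j).1)
  rw [regObjective_eq D hδ hu hv0 (fun j => (hw j).1) X hXΩ.1,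
    regObjective_eq D hδ hu hv0 (fun j => (hw j).1) Y hY.1, ← hX]
  refine mul_lt_mul_of_pos_left ?_ hδ
  -- Complementary slackness: a nonzero logarithm forces the column sum of `X` to the bound that is
  -- extremal for its sign.
  have h1 : ∑ j, (Real.log (v j) + Real.log (w j)) * ∑ i, X i j ≤
      ∑ j, (Real.log (v j) + Real.log (w j)) * ∑ i, Y i j := by
    refine Finset.sum_le_sum fun j _ => ?_
    rw [add_mul, add_mul]
    refine add_le_add ?_ ?_
    · rcases (hv j).eq_or_lt with h | h
      · simp [← h]
      · rw [hbl j h]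
        exact mul_le_mul_of_nonneg_left (hY.2.1 j).1 (Real.log_nonneg (hv j))
    · rcases (hw j).2.eq_or_lt with h | h
      · simp [h]
      · rw [hbu j h]
        exact mul_le_mul_of_nonpos_left (hY.2.1 j).2 (Real.log_nonpos (hw j).1.le (hw j).2)
  have h2 : 0 < ∑ i, ∑ j, Y i j * (Real.log (Y i j) - Real.log (X i j)) := by
    obtain ⟨i₀, j₀, h0⟩ : ∃ i j, Y i j ≠ X i j := by
      by_contra! h
      exact hne (Matrix.ext h)
    -- Equal total mass cancels the linear part of the entrywise Gibbs inequality.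
    have hz : ∑ i, ∑ j, (Y i j - X i j) = 0 := by
      simp only [Finset.sum_sub_distrib, hY.1, hXΩ.1, sub_self, Finset.sum_const_zero]
    rw [← hz]
    have hle : ∀ i j, Y i j - X i j ≤ Y i j * (Real.log (Y i j) - Real.log (X i j)) :=
      fun i j => sub_le_mul_log_sub (hXpos i j) (hY.2.2 i j)
    refine Finset.sum_lt_sum (fun i _ => Finset.sum_le_sum fun j _ => hle i j)
      ⟨i₀, Finset.mem_univ _, ?_⟩
    exact Finset.sum_lt_sum (fun j _ => hle i₀ j)
      ⟨j₀, Finset.mem_univ _, sub_lt_mul_log_sub (hXpos _ _) (hY.2.2 _ _) h0⟩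
  simp only [sub_self, mul_zero, Finset.sum_const_zero, zero_add]
  linarith

/-! ### Orbits of maps that are nonexpansive for Thompson's part metric -/

lemma tendsto_of_eventually_mul_le {ι : Type*} {z : ℕ → ι → ℝ} {x : ι → ℝ}
    (hx : ∀ i, 0 < x i)
    (h : ∀ t : ℝ, 1 < t → ∀ᶠ k in atTop, ∀ i, z k i ≤ t * x i ∧ x i ≤ t * z k i) :
    Tendsto z atTop (𝓝 x) := by
  refine tendsto_pi_nhds.2 fun i => ?_
  refine tendsto_order.2 ⟨fun a ha => ?_, fun a ha => ?_⟩
  · rcases le_or_gt a 0 with h0 | h0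
    · filter_upwards [h 2 one_lt_two] with k hk
      have := (hk i).2
      have := hx i
      linarith
    · obtain ⟨t, ht1, ht2⟩ := exists_between ((one_lt_div h0).2 ha)
      filter_upwards [h t ht1] with k hk
      rw [lt_div_iff₀ h0] at ht2
      exact lt_of_mul_lt_mul_left (ht2.trans_le (hk i).2) (zero_le_one.trans ht1.le)
  · obtain ⟨t, ht1, ht2⟩ := exists_between ((one_lt_div (hx i)).2 ha)
    filter_upwards [h t ht1] with k hk
    rw [lt_div_iff₀ (hx i)] at ht2
    exact (hk i).1.trans_lt ht2

lemma eventually_mul_le_of_tendsto {ι : Type*} [Finite ι] {α : Type*} {l : Filter α}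
    {z : α → ι → ℝ} {x : ι → ℝ} (hz : Tendsto z l (𝓝 x)) (hx : ∀ i, 0 < x i) {t : ℝ}
    (ht : 1 < t) : ∀ᶠ k in l, ∀ i, z k i ≤ t * x i ∧ x i ≤ t * z k i := by
  refine eventually_all.2 fun i => ?_
  have hi := tendsto_pi_nhds.1 hz i
  have h1 : ∀ᶠ k in l, z k i < t * x i := hi.eventually_lt_const (by nlinarith [hx i])
  have h2 : ∀ᶠ k in l, x i < t * z k i :=
    (hi.const_mul t).eventually_const_lt (by nlinarith [hx i])
  filter_upwards [h1, h2] with k a b using ⟨a.le, b.le⟩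

lemma le_of_forall_one_lt_le_mul {a b : ℝ} (h : ∀ t : ℝ, 1 < t → a ≤ t * b) : a ≤ b := by
  have h1 : Tendsto (fun t : ℝ => t * b) (𝓝[>] 1) (𝓝 (1 * b)) :=
    ((continuous_id.mul continuous_const).tendsto 1).mono_left nhdsWithin_le_nhds
  rw [one_mul] at h1
  exact ge_of_tendsto h1 (eventually_nhdsWithin_of_forall h)

/-- Compactness gives a cluster point, and `hreg` makes it fixed by `T`. Once a single iterate is
within a factor `t` of this fixed point, nonexpansiveness keeps all later ones there. -/
lemma exists_tendsto_of_thompson_nonexpansive {ι : Type*} [Finite ι] {T : (ι → ℝ) → ι → ℝ}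
    (hT : ∀ x y : ι → ℝ, (∀ i, 0 < x i) → (∀ i, 0 < y i) → ∀ t : ℝ, 1 ≤ t →
      (∀ i, x i ≤ t * y i) → ∀ i, T x i ≤ t * T y i)
    (hcont : ∀ x : ι → ℝ, (∀ i, 0 < x i) → ContinuousAt T x)
    {z : ℕ → ι → ℝ} (hz : ∀ k, z (k + 1) = T (z k)) {m M : ι → ℝ} (hm : ∀ i, 0 < m i)
    (hb : ∀ k, z k ∈ Set.Icc m M)
    (hreg : ∀ t : ℝ, 1 < t → ∀ᶠ k in atTop, ∀ i, z (k + 1) i ≤ t * z k i ∧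
      z k i ≤ t * z (k + 1) i) :
    ∃ x : ι → ℝ, (∀ i, 0 < x i) ∧ Tendsto z atTop (𝓝 x) := by
  have := Fintype.ofFinite ι
  obtain ⟨x, hxm, φ, hφ, hlim⟩ := (isCompact_Icc (a := m) (b := M)).tendsto_subseq hb
  have hx : ∀ i, 0 < x i := fun i => (hm i).trans_le (hxm.1 i)
  have hzpos : ∀ k i, 0 < z k i := fun k i => (hm i).trans_le ((hb k).1 i)
  have hlim' : Tendsto (fun k => z (φ k + 1)) atTop (𝓝 (T x)) := by
    simp only [hz]
    exact (hcont x hx).tendsto.comp hlim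
  have hfix : T x = x := by
    have key : ∀ t : ℝ, 1 < t → ∀ i, T x i ≤ t * x i ∧ x i ≤ t * T x i := by
      intro t ht i
      have h1 := tendsto_pi_nhds.1 hlim i
      have h2 := tendsto_pi_nhds.1 hlim' i
      have h3 := hφ.tendsto_atTop.eventually (hreg t ht)
      exact ⟨le_of_tendsto_of_tendsto h2 (h1.const_mul t) (h3.mono fun k hk => (hk i).1),
        le_of_tendsto_of_tendsto h1 (h2.const_mul t) (h3.mono fun k hk => (hk i).2)⟩
    funext i
    exact le_antisymm (le_of_forall_one_lt_le_mul fun t ht => (key t ht i).1)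
      (le_of_forall_one_lt_le_mul fun t ht => (key t ht i).2)
  refine ⟨x, hx, tendsto_of_eventually_mul_le hx fun t ht => ?_⟩
  obtain ⟨k, hk⟩ := (eventually_mul_le_of_tendsto hlim hx ht).exists
  refine eventually_atTop.2 ⟨φ k, fun l hl => ?_⟩
  induction l, hl using Nat.le_induction with
  | base => exact hk
  | succ l _ ih =>
    intro i
    have h1 := hT _ _ (hzpos l) hx t ht.le (fun i => (ih i).1) i
    have h2 := hT _ _ hx (hzpos l) t ht.le (fun i => (ih i).2) i
    rw [hfix] at h1 h2
    rw [hz]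
    exact ⟨h1, h2⟩

/-! ### Positive matrices -/

lemma mulVec_pos {m l : Type*} [Fintype l] [Nonempty l] {A : Matrix m l ℝ}
    (hA : ∀ i j, 0 < A i j) {x : l → ℝ} (hx : ∀ j, 0 < x j) (i : m) : 0 < (A *ᵥ x) i :=
  Finset.sum_pos (fun j _ => mul_pos (hA i j) (hx j)) Finset.univ_nonempty

lemma mulVec_le_mul_mulVec {m l : Type*} [Fintype l] {A : Matrix m l ℝ}
    (hA : ∀ i j, 0 < A i j) {x y : l → ℝ} {t : ℝ} (h : ∀ j, x j ≤ t * y j) (i : m) :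
    (A *ᵥ x) i ≤ t * (A *ᵥ y) i := by
  simp only [Matrix.mulVec, dotProduct, Finset.mul_sum]
  refine Finset.sum_le_sum fun j _ => ?_
  calc A i j * x j ≤ A i j * (t * y j) := mul_le_mul_of_nonneg_left (h j) (hA i j).le
    _ = t * (A i j * y j) := by ring

/-- The scaling `1 ./ (K z)` that gives `diag(u) K diag(z)` unit row sums. -/
noncomputable def rowScale {n c : ℕ} (K : Matrix (Fin n) (Fin c) ℝ) (z : Fin c → ℝ) : Fin n → ℝ :=
  fun i => 1 / (K *ᵥ z) i

section

variable {n c : ℕ} {K : Matrix (Fin n) (Fin c) ℝ}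

lemma rowScale_pos [NeZero c] (hK : ∀ i j, 0 < K i j) {z : Fin c → ℝ} (hz : ∀ j, 0 < z j) (i : Fin n) :
    0 < rowScale K z i := one_div_pos.2 (mulVec_pos hK hz i)

lemma rowScale_le_mul [NeZero c] (hK : ∀ i j, 0 < K i j) {x y : Fin c → ℝ} (hx : ∀ j, 0 < x j)
    (hy : ∀ j, 0 < y j) {t : ℝ} (h : ∀ j, x j ≤ t * y j) (i : Fin n) :
    rowScale K y i ≤ t * rowScale K x i := by
  have h1 := mulVec_le_mul_mulVec hK h i
  have hx' := mulVec_pos hK hx i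
  have hy' := mulVec_pos hK hy i
  rw [rowScale, rowScale, mul_one_div, div_le_div_iff₀ hy' hx', one_mul]
  exact h1

lemma continuousAt_rowScale [NeZero c] (hK : ∀ i j, 0 < K i j) {z : Fin c → ℝ} (hz : ∀ j, 0 < z j) :
    ContinuousAt (rowScale K) z := by
  refine continuousAt_pi.2 fun i => ?_
  refine ContinuousAt.div continuousAt_const ?_ (mulVec_pos hK hz i).ne'
  exact ((continuous_apply i).comp (Continuous.matrix_mulVec continuous_const continuous_id)
    ).continuousAt

lemma rowScale_smul (z : Fin c → ℝ) (s : ℝ) : rowScale K (s • z) = s⁻¹ • rowScale K z := by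
  funext i
  simp only [rowScale, Matrix.mulVec_smul, Pi.smul_apply, smul_eq_mul]
  rw [one_div, mul_inv, one_div]

/-! ### Matrix scaling with equal column sums -/

/-- The dual potential of the balanced scaling problem with unit row sums and column sums
`b`. -/
noncomputable def scalingPotential {n c : ℕ} (K : Matrix (Fin n) (Fin c) ℝ) (b : ℝ) (z : Fin c → ℝ) : ℝ :=
  b * ∑ j, Real.log (z j) - ∑ i, Real.log ((K *ᵥ z) i)

/-- The balance `b * c = n` between column and row mass makes the potential homogeneous of degree
zero. -/
lemma scalingPotential_smul [NeZero c] (hK : ∀ i j, 0 < K i j) {b : ℝ} (hb : b * c = n) {z : Fin c → ℝ}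
    (hz : ∀ j, 0 < z j) {s : ℝ} (hs : 0 < s) :
    scalingPotential K b (s • z) = scalingPotential K b z := by
  have h1 : ∑ j, Real.log ((s • z) j) = c * Real.log s + ∑ j, Real.log (z j) := by
    simp [Real.log_mul hs.ne' (hz _).ne', Finset.sum_add_distrib]
  have h2 : ∑ i, Real.log ((K *ᵥ (s • z)) i) = n * Real.log s + ∑ i, Real.log ((K *ᵥ z) i) := by
    simp [Matrix.mulVec_smul, Real.log_mul hs.ne' (mulVec_pos hK hz _).ne',
      Finset.sum_add_distrib]
  rw [scalingPotential, scalingPotential, h1, h2, ← hb]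
  ring

lemma exists_max_scalingPotential [NeZero n] [NeZero c] (hK : ∀ i j, 0 < K i j) {b : ℝ} (hb : b * c = n) :
    ∃ x : Fin c → ℝ, (∀ j, 0 < x j) ∧
      ∀ y : Fin c → ℝ, (∀ j, 0 < y j) → scalingPotential K b y ≤ scalingPotential K b x := by
  have hn : (0 : ℝ) < n := by exact_mod_cast Nat.pos_of_ne_zero (NeZero.ne n)
  have hc : (0 : ℝ) < c := by exact_mod_cast Nat.pos_of_ne_zero (NeZero.ne c)
  have hb0 : 0 < b := pos_of_mul_pos_left (hb ▸ hn) hc.le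
  obtain ⟨p, hp⟩ := Finite.exists_min fun p : Fin n × Fin c => K p.1 p.2
  set κ := K p.1 p.2
  have hκ : 0 < κ := hK _ _
  set P := scalingPotential K b
  -- Chosen so that a vector with largest entry `1` and some entry below `ε` has potential less than
  -- `P 1`; the maximum over the box is then global.
  set ε := min 1 (Real.exp ((P 1 + n * Real.log κ) / b))
  have hε : 0 < ε := lt_min one_pos (Real.exp_pos _)
  have hpos : ∀ {x : Fin c → ℝ}, x ∈ Set.Icc (fun _ => ε) (1 : Fin c → ℝ) → ∀ j, 0 < x j :=
    fun hx j => hε.trans_le (hx.1 j)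
  have hcont : ContinuousOn P (Set.Icc (fun _ => ε) (1 : Fin c → ℝ)) := by
    refine ContinuousOn.sub (continuousOn_const.mul (continuousOn_finsetSum _ fun j _ => ?_))
      (continuousOn_finsetSum _ fun i _ => ?_)
    · exact (continuous_apply j).continuousOn.log fun x hx => (hpos hx j).ne'
    · exact ((continuous_apply i).comp (Continuous.matrix_mulVec continuous_const
        continuous_id)).continuousOn.log fun x hx => (mulVec_pos hK (hpos hx) i).ne'
  have h1mem : (1 : Fin c → ℝ) ∈ Set.Icc (fun _ => ε) (1 : Fin c → ℝ) :=
    ⟨fun _ => min_le_left _ _, le_rfl⟩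
  obtain ⟨x, hxm, hx⟩ := isCompact_Icc.exists_isMaxOn ⟨_, h1mem⟩ hcont
  refine ⟨x, hpos hxm, fun y hy => ?_⟩
  obtain ⟨q, hq⟩ := Finite.exists_max y
  have hs : 0 < (y q)⁻¹ := inv_pos.2 (hy q)
  rw [← show P ((y q)⁻¹ • y) = P y from scalingPotential_smul hK hb hy hs]
  set z := (y q)⁻¹ • y with hzdef
  have hz : ∀ j, 0 < z j := fun j => mul_pos hs (hy j)
  have hzq : z q = 1 := inv_mul_cancel₀ (hy q).ne'
  have hz1 : ∀ j, z j ≤ 1 := fun j => by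
    rw [← hzq]
    exact mul_le_mul_of_nonneg_left (hq j) hs.le
  by_cases hzε : ∀ j, ε ≤ z j
  · exact hx ⟨hzε, hz1⟩
  · push Not at hzε
    obtain ⟨j, hj⟩ := hzε
    refine le_trans ?_ (hx h1mem)
    have e1 : ∑ l, Real.log (z l) ≤ Real.log (z j) := by
      have := Finset.single_le_sum (f := fun l => -Real.log (z l))
        (fun l _ => neg_nonneg.2 (Real.log_nonpos (hz l).le (hz1 l))) (Finset.mem_univ j)
      rw [Finset.sum_neg_distrib] at this
      linarith
    have e2 : n * Real.log κ ≤ ∑ i, Real.log ((K *ᵥ z) i) := by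
      have : ∀ i, Real.log κ ≤ Real.log ((K *ᵥ z) i) := by
        intro i
        refine Real.log_le_log hκ ?_
        calc κ ≤ K i q * z q := by rw [hzq, mul_one]; exact hp (i, q)
          _ ≤ (K *ᵥ z) i := Finset.single_le_sum (f := fun l => K i l * z l)
            (fun l _ => (mul_pos (hK i l) (hz l)).le) (Finset.mem_univ q)
      simpa using Finset.sum_le_sum fun i (_ : i ∈ Finset.univ) => this i
    have e3 : b * Real.log (z j) < P 1 + n * Real.log κ := by
      have := hj.trans_le (min_le_right _ _)
      rw [← Real.log_lt_iff_lt_exp (hz j), lt_div_iff₀ hb0] at this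
      linarith
    have e4 := mul_le_mul_of_nonneg_left e1 hb0.le
    have : P z = b * ∑ l, Real.log (z l) - ∑ i, Real.log ((K *ᵥ z) i) := rfl
    linarith

/-- These are the first-order conditions, one coordinate direction at a time, at a maximizer of the
potential. -/
lemma exists_balanced_scaling [NeZero n] [NeZero c] (hK : ∀ i j, 0 < K i j) {b : ℝ} (hb : b * c = n) :
    ∃ x : Fin c → ℝ, (∀ j, 0 < x j) ∧ ∀ j, (Kᵀ *ᵥ rowScale K x) j = b / x j := by
  obtain ⟨x, hx, hmax⟩ := exists_max_scalingPotential hK hb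
  refine ⟨x, hx, fun j => ?_⟩
  set d : Fin c → ℝ := Pi.single j 1 with hd
  have hpos : ∀ᶠ t : ℝ in 𝓝 0, ∀ l, 0 < (x + t • d) l := by
    refine eventually_all.2 fun l => ?_
    have hc : Continuous fun t : ℝ => (x + t • d) l := by
      simp only [Pi.add_apply, Pi.smul_apply, smul_eq_mul]
      fun_prop
    exact hc.continuousAt.eventually_const_lt (by simpa using hx l)
  have hloc : IsLocalMax (fun t : ℝ => scalingPotential K b (x + t • d)) 0 := by
    filter_upwards [hpos] with t ht
    simpa using hmax _ ht
  have hlin : ∀ a e : ℝ, 0 < a → HasDerivAt (fun t : ℝ => Real.log (a + t * e)) (e / a) 0 := by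
    intro a e ha
    have h := (((hasDerivAt_id (0 : ℝ)).mul_const e).const_add a).log (by simpa using ha.ne')
    simpa using h
  have hder : HasDerivAt (fun t : ℝ => scalingPotential K b (x + t • d))
      (b * ∑ l, d l / x l - ∑ i, (K *ᵥ d) i / (K *ᵥ x) i) 0 := by
    simp only [scalingPotential, Matrix.mulVec_add, Matrix.mulVec_smul, Pi.add_apply,
      Pi.smul_apply, smul_eq_mul]
    refine HasDerivAt.sub (HasDerivAt.const_mul _ (HasDerivAt.fun_sum fun l _ => ?_))
      (HasDerivAt.fun_sum fun i _ => ?_)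
    · exact hlin _ _ (hx l)
    · exact hlin _ _ (mulVec_pos hK hx i)
  have h0 := hloc.hasDerivAt_eq_zero hder
  have h1 : ∑ l, d l / x l = 1 / x j := by
    rw [Finset.sum_eq_single j (fun l _ hl => by simp [hd, hl]) (by simp)]
    simp [hd]
  have h2 : ∑ i, (K *ᵥ d) i / (K *ᵥ x) i = (Kᵀ *ᵥ rowScale K x) j := by
    simp only [hd, Matrix.mulVec_single_one, Matrix.col_apply]
    simp [Matrix.mulVec, dotProduct, rowScale, div_eq_mul_inv]
  rw [h1, h2] at h0
  rw [← sub_eq_zero.1 h0, mul_one_div]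

/-! ### The reduced iteration in `z = v ⊙ w` -/

/-- The product of the column scalings after one sweep, when it is determined by the product
before the sweep. -/
noncomputable def reducedStep {n c : ℕ} (K : Matrix (Fin n) (Fin c) ℝ) (bl bu : ℝ) (z : Fin c → ℝ) :
    Fin c → ℝ :=
  fun j => min (max (bl / (Kᵀ *ᵥ rowScale K z) j) 1) (bu / (Kᵀ *ᵥ rowScale K z) j)

/-- The clipped value is antitone in `a`, and dividing `a` by `t ≥ 1` multiplies it by at most `t`.
A negative `bl` is harmless because of the maximum with `1`. -/
lemma clip_le_mul {bl bu a a' t : ℝ} (ha : 0 < a) (ha' : 0 < a') (ht : 1 ≤ t) (hbu : 0 ≤ bu)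
    (h : a' ≤ t * a) :
    min (max (bl / a) 1) (bu / a) ≤ t * min (max (bl / a') 1) (bu / a') := by
  have ht0 : 0 ≤ t := zero_le_one.trans ht
  have key : ∀ {b : ℝ}, 0 ≤ b → b / a ≤ t * (b / a') := by
    intro b hb
    rw [← mul_div_assoc, div_le_div_iff₀ ha ha']
    nlinarith [mul_le_mul_of_nonneg_left h hb]
  rw [mul_min_of_nonneg _ _ ht0, mul_max_of_nonneg _ _ ht0, mul_one]
  refine min_le_min (max_le ?_ (le_max_of_le_right ht)) (key hbu)
  rcases le_total 0 bl with hb | hb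
  · exact le_max_of_le_left (key hb)
  · exact le_max_of_le_right ((div_nonpos_of_nonpos_of_nonneg hb ha.le).trans
      (zero_le_one.trans ht))

lemma colScale_pos [NeZero n] (hK : ∀ i j, 0 < K i j) {u : Fin n → ℝ} (hu : ∀ i, 0 < u i) (j : Fin c) :
    0 < (Kᵀ *ᵥ u) j :=
  mulVec_pos (fun j i => hK i j) hu j

lemma reducedStep_le_mul [NeZero n] [NeZero c] (hK : ∀ i j, 0 < K i j) {bl bu : ℝ} (hbu : 0 ≤ bu)
    {x y : Fin c → ℝ} (hx : ∀ j, 0 < x j) (hy : ∀ j, 0 < y j) {t : ℝ} (ht : 1 ≤ t)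
    (h : ∀ j, x j ≤ t * y j) (j : Fin c) :
    reducedStep K bl bu x j ≤ t * reducedStep K bl bu y j :=
  clip_le_mul (colScale_pos hK (rowScale_pos hK hx) j) (colScale_pos hK (rowScale_pos hK hy) j)
    ht hbu (mulVec_le_mul_mulVec (fun j i => hK i j) (rowScale_le_mul hK hx hy h) j)

lemma continuousAt_reducedStep [NeZero n] [NeZero c] (hK : ∀ i j, 0 < K i j) (bl bu : ℝ) {z : Fin c → ℝ}
    (hz : ∀ j, 0 < z j) : ContinuousAt (reducedStep K bl bu) z := by
  refine continuousAt_pi.2 fun j => ?_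
  have h1 : ContinuousAt (fun z => (Kᵀ *ᵥ rowScale K z) j) z :=
    ((continuous_apply j).comp (Continuous.matrix_mulVec continuous_const continuous_id)
      ).continuousAt.comp (continuousAt_rowScale hK hz)
  have h2 := (colScale_pos hK (rowScale_pos hK hz) j).ne'
  exact ((continuousAt_const.div h1 h2).max continuousAt_const).min
    (continuousAt_const.div h1 h2)

/-- Orbits of `reducedStep` stay between two multiples of the balanced scaling. -/
lemma exists_bounds_reducedStep [NeZero n] [NeZero c] (hK : ∀ i j, 0 < K i j) {bl bu : ℝ} (hbl : bl * c ≤ n)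
    (hbu : (n : ℝ) ≤ bu * c) {z : ℕ → Fin c → ℝ} (h0 : ∀ j, 0 < z 0 j)
    (hz : ∀ k, z (k + 1) = reducedStep K bl bu (z k)) :
    ∃ m M : Fin c → ℝ, (∀ j, 0 < m j) ∧ ∀ k, z k ∈ Set.Icc m M := by
  have hn : (0 : ℝ) < n := by exact_mod_cast Nat.pos_of_ne_zero (NeZero.ne n)
  have hc : (0 : ℝ) < c := by exact_mod_cast Nat.pos_of_ne_zero (NeZero.ne c)
  set b : ℝ := n / c with hbdef
  have hb : b * c = n := div_mul_cancel₀ _ hc.ne'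
  have hb0 : 0 < b := div_pos hn hc
  have hblb : bl ≤ b := (le_div_iff₀ hc).2 hbl
  have hbub : b ≤ bu := (div_le_iff₀ hc).2 hbu
  have hbu0 : 0 ≤ bu := hb0.le.trans hbub
  obtain ⟨x, hx, hxb⟩ := exists_balanced_scaling hK hb
  have hcol : ∀ s : ℝ, 0 < s → ∀ j, (Kᵀ *ᵥ rowScale K (s • x)) j = b / (s * x j) := by
    intro s hs j
    rw [rowScale_smul, Matrix.mulVec_smul, Pi.smul_apply, hxb, smul_eq_mul]
    have := hx j
    field_simp
  obtain ⟨s, hs, hs1⟩ : ∃ s : ℝ, 0 < s ∧ ∀ j, s * x j ≤ 1 ∧ s * x j ≤ z 0 j := by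
    obtain ⟨p, hp⟩ := Finite.exists_min fun j => min 1 (z 0 j) / x j
    refine ⟨_, div_pos (lt_min one_pos (h0 p)) (hx p), fun j => ?_⟩
    have := (le_div_iff₀ (hx j)).1 (hp j)
    exact ⟨this.trans (min_le_left _ _), this.trans (min_le_right _ _)⟩
  obtain ⟨S, hS, hS1⟩ : ∃ S : ℝ, 0 < S ∧ ∀ j, 1 ≤ S * x j ∧ z 0 j ≤ S * x j := by
    obtain ⟨p, hp⟩ := Finite.exists_max fun j => max 1 (z 0 j) / x j
    refine ⟨max 1 (z 0 p) / x p, div_pos (lt_max_of_lt_left one_pos) (hx p), fun j => ?_⟩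
    have := (div_le_iff₀ (hx j)).1 (hp j)
    exact ⟨(le_max_left _ _).trans this, (le_max_right _ _).trans this⟩
  have hsx : ∀ j, 0 < (s • x) j := fun j => mul_pos hs (hx j)
  have hSx : ∀ j, 0 < (S • x) j := fun j => mul_pos hS (hx j)
  -- Small multiples of `x` are subsolutions since `b ≤ bu`, and large ones supersolutions since `bl
  -- ≤ b`; monotonicity, the case `t = 1`, traps the orbit.
  have hlow : ∀ j, (s • x) j ≤ reducedStep K bl bu (s • x) j := by
    intro j
    rw [reducedStep, hcol s hs, Pi.smul_apply, smul_eq_mul]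
    refine le_min (le_max_of_le_right (hs1 j).1) ?_
    rw [div_div_eq_mul_div, le_div_iff₀ hb0, mul_comm]
    exact mul_le_mul_of_nonneg_right hbub (hsx j).le
  have hup : ∀ j, reducedStep K bl bu (S • x) j ≤ (S • x) j := by
    intro j
    rw [reducedStep, hcol S hS, Pi.smul_apply, smul_eq_mul]
    refine min_le_of_left_le (max_le ?_ (hS1 j).1)
    rw [div_div_eq_mul_div, div_le_iff₀ hb0, mul_comm]
    exact mul_le_mul_of_nonneg_left hblb (hSx j).le
  refine ⟨s • x, S • x, hsx, fun k => ?_⟩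
  induction k with
  | zero => exact ⟨fun j => (hs1 j).2, fun j => (hS1 j).2⟩
  | succ k ih =>
    have hzk : ∀ j, 0 < z k j := fun j => (hsx j).trans_le (ih.1 j)
    rw [hz]
    refine ⟨fun j => (hlow j).trans ?_, fun j => le_trans ?_ (hup j)⟩
    · simpa using reducedStep_le_mul hK hbu0 hsx hzk le_rfl
        (fun l => (ih.1 l).trans_eq (one_mul _).symm) j
    · simpa using reducedStep_le_mul hK hbu0 hzk hSx le_rfl
        (fun l => (ih.2 l).trans_eq (one_mul _).symm) j

end

/-! ### Dual ascent -/

/-- The bounds on the scalings that hold after every sweep. -/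
structure ScalingState.Admissible {n c : ℕ} (s : ScalingState n c) : Prop where
  u_pos : ∀ i, 0 < s.u i
  one_le_v : ∀ j, 1 ≤ s.v j
  w_pos : ∀ j, 0 < s.w j
  w_le_one : ∀ j, s.w j ≤ 1

namespace ScalingState.Admissible

variable {n c : ℕ} {s : ScalingState n c}

lemma v_pos (h : s.Admissible) (j : Fin c) : 0 < s.v j := one_pos.trans_le (h.one_le_v j)

lemma vw_pos (h : s.Admissible) (j : Fin c) : 0 < (s.v * s.w) j :=
  mul_pos (h.v_pos j) (h.w_pos j)

end ScalingState.Admissible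

/-- The objective of the dual problem in the variables `log u`, `log v`, `-log w`. -/
noncomputable def dualObjective {n c : ℕ} (K : Matrix (Fin n) (Fin c) ℝ) (bl bu : ℝ)
    (u : Fin n → ℝ) (v w : Fin c → ℝ) : ℝ :=
  ∑ i, Real.log (u i) + ∑ j, (bl * Real.log (v j) + bu * Real.log (w j)) -
    ∑ i, ∑ j, scaled K u v w i j

/-- The update is the exact maximizer of the concave function `bl * log v - s * v` over `v ≥ 1`, or
the endpoint `1` when `bl ≤ s`. -/
lemma lower_update_ascent {bl s v : ℝ} (hs : 0 < s) (hv : 1 ≤ v) :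
    bl * Real.log v - s * v ≤ bl * Real.log (max (bl / s) 1) - s * max (bl / s) 1 := by
  have hv0 : 0 < v := one_pos.trans_le hv
  rcases le_total bl s with h | h
  · rw [max_eq_right ((div_le_one hs).2 h), Real.log_one]
    have h1 := Real.log_le_sub_one_of_pos hv0
    have h2 := Real.log_nonneg hv
    nlinarith
  · have hb : 0 < bl := hs.trans_le h
    rw [max_eq_left ((one_le_div hs).2 h), mul_div_cancel₀ _ hs.ne']
    have h1 := Real.log_le_sub_one_of_pos (mul_pos hv0 (div_pos hs hb))
    rw [Real.log_mul hv0.ne' (div_pos hs hb).ne', Real.log_div hs.ne' hb.ne'] at h1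
    rw [Real.log_div hb.ne' hs.ne']
    have h2 := mul_le_mul_of_nonneg_left h1 hb.le
    have h3 : bl * (v * (s / bl) - 1) = s * v - bl := by field_simp
    linarith

lemma upper_update_ascent {bu s w : ℝ} (hs : 0 < s) (hbu : 0 < bu) (hw0 : 0 < w) (hw : w ≤ 1) :
    bu * Real.log w - s * w ≤ bu * Real.log (min (bu / s) 1) - s * min (bu / s) 1 := by
  rcases le_total s bu with h | h
  · rw [min_eq_right ((one_le_div hs).2 h), Real.log_one]
    have h1 := Real.log_le_sub_one_of_pos hw0
    nlinarith
  · rw [min_eq_left ((div_le_one hs).2 h), mul_div_cancel₀ _ hs.ne']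
    have h1 := Real.log_le_sub_one_of_pos (mul_pos hw0 (div_pos hs hbu))
    rw [Real.log_mul hw0.ne' (div_pos hs hbu).ne', Real.log_div hs.ne' hbu.ne'] at h1
    rw [Real.log_div hbu.ne' hs.ne']
    have h2 := mul_le_mul_of_nonneg_left h1 hbu.le
    have h3 : bu * (w * (s / bu) - 1) = s * w - bu := by field_simp
    linarith

section

variable {n c : ℕ} {K : Matrix (Fin n) (Fin c) ℝ} {bl bu : ℝ}

lemma dualObjective_eq_row (u : Fin n → ℝ) (v w : Fin c → ℝ) :
    dualObjective K bl bu u v w = ∑ i, (Real.log (u i) - u i * (K *ᵥ (v * w)) i) +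
      ∑ j, (bl * Real.log (v j) + bu * Real.log (w j)) := by
  simp only [dualObjective, sum_scaled_row, Finset.sum_sub_distrib]
  ring

lemma dualObjective_eq_col (u : Fin n → ℝ) (v w : Fin c → ℝ) :
    dualObjective K bl bu u v w = ∑ i, Real.log (u i) +
      ∑ j, (bl * Real.log (v j) + bu * Real.log (w j) - (Kᵀ *ᵥ u) j * (v j * w j)) := by
  have h : ∑ i, ∑ j, scaled K u v w i j = ∑ j, (Kᵀ *ᵥ u) j * (v j * w j) :=
    Finset.sum_comm.trans (Finset.sum_congr rfl fun j _ => sum_scaled_col K u v w j)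
  rw [dualObjective, h, Finset.sum_sub_distrib, add_sub_assoc]

lemma admissible_sweep [NeZero n] [NeZero c] (hK : ∀ i j, 0 < K i j) (hbu : 0 < bu)
    {s : ScalingState n c} (hv : ∀ j, 0 < s.v j) (hw : ∀ j, 0 < s.w j) :
    (sweep K bl bu s).Admissible where
  u_pos := rowScale_pos hK fun j => mul_pos (hv j) (hw j)
  one_le_v _ := le_max_right _ _
  w_pos j := lt_min (div_pos hbu (mul_pos (colScale_pos hK
    (rowScale_pos hK fun j => mul_pos (hv j) (hw j)) j)
    (one_pos.trans_le (le_max_right _ _)))) one_pos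
  w_le_one _ := min_le_right _ _

lemma dualObjective_sweep [NeZero n] [NeZero c] (hK : ∀ i j, 0 < K i j) (hbu : 0 < bu)
    {s : ScalingState n c} (hs : s.Admissible) :
    dualObjective K bl bu s.u s.v s.w +
        ∑ i, (Real.sqrt (s.u i / (sweep K bl bu s).u i) - 1) ^ 2 ≤
      dualObjective K bl bu (sweep K bl bu s).u (sweep K bl bu s).v (sweep K bl bu s).w := by
  set s' := sweep K bl bu s with hs'
  have hadm : s'.Admissible := admissible_sweep hK hbu hs.v_pos hs.w_pos
  have ha := colScale_pos hK hadm.u_pos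
  have h1 : dualObjective K bl bu s.u s.v s.w + ∑ i, (Real.sqrt (s.u i / s'.u i) - 1) ^ 2 ≤
      dualObjective K bl bu s'.u s.v s.w := by
    rw [dualObjective_eq_row, dualObjective_eq_row, add_right_comm, ← Finset.sum_add_distrib]
    refine add_le_add (Finset.sum_le_sum fun i _ => ?_) le_rfl
    have hz := mulVec_pos hK hs.vw_pos i
    have hu' : s'.u i = 1 / (K *ᵥ (s.v * s.w)) i := rfl
    set r := s.u i / s'.u i with hr
    have hr0 : 0 < r := div_pos (hs.u_pos i) (hadm.u_pos i)
    have e1 : s.u i * (K *ᵥ (s.v * s.w)) i = r := by rw [hr, hu']; simp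
    have e2 : s'.u i * (K *ᵥ (s.v * s.w)) i = 1 := by rw [hu']; field_simp
    have e3 : Real.log r = Real.log (s.u i) - Real.log (s'.u i) :=
      Real.log_div (hs.u_pos i).ne' (hadm.u_pos i).ne'
    -- Applying `log x ≤ x - 1` to `√r` instead of `r` leaves the gain `(√r - 1) ^ 2`.
    have e4 : Real.log r = 2 * Real.log (Real.sqrt r) := by
      rw [Real.log_sqrt hr0.le]; ring
    have e5 := Real.log_le_sub_one_of_pos (Real.sqrt_pos.2 hr0)
    have e6 := Real.sq_sqrt hr0.le
    rw [e1, e2]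
    nlinarith
  have h2 : dualObjective K bl bu s'.u s.v s.w ≤ dualObjective K bl bu s'.u s'.v s.w := by
    rw [dualObjective_eq_col, dualObjective_eq_col]
    refine add_le_add le_rfl (Finset.sum_le_sum fun j _ => ?_)
    have hv' : s'.v j = max (bl / ((Kᵀ *ᵥ s'.u) j * s.w j)) 1 := rfl
    have := lower_update_ascent (bl := bl) (mul_pos (ha j) (hs.w_pos j)) (hs.one_le_v j)
    rw [← hv'] at this
    linarith
  have h3 : dualObjective K bl bu s'.u s'.v s.w ≤ dualObjective K bl bu s'.u s'.v s'.w := by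
    rw [dualObjective_eq_col, dualObjective_eq_col]
    refine add_le_add le_rfl (Finset.sum_le_sum fun j _ => ?_)
    have hw' : s'.w j = min (bu / ((Kᵀ *ᵥ s'.u) j * s'.v j)) 1 := rfl
    have := upper_update_ascent (mul_pos (ha j) (hadm.v_pos j)) hbu (hs.w_pos j)
      (hs.w_le_one j)
    rw [← hw'] at this
    linarith
  exact h1.trans (h2.trans h3)

/-- Weak duality against the uniform matrix `1 / c`. -/
lemma dualObjective_le [NeZero c] (hK : ∀ i j, 0 < K i j) (hbl : bl * c ≤ n)
    (hbu : (n : ℝ) ≤ bu * c) {s : ScalingState n c} (hs : s.Admissible) :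
    dualObjective K bl bu s.u s.v s.w ≤ -∑ i, ∑ j, Real.log (K i j) / c := by
  have hc : (1 : ℝ) ≤ c := by exact_mod_cast Nat.one_le_iff_ne_zero.2 (NeZero.ne c)
  have hc0 : (0 : ℝ) < c := one_pos.trans_le hc
  have h1 : ∑ i, Real.log (s.u i) = ∑ i, ∑ _j : Fin c, Real.log (s.u i) / c := by
    simp only [Finset.sum_const, Finset.card_univ, Fintype.card_fin, nsmul_eq_mul]
    exact Finset.sum_congr rfl fun i _ => (mul_div_cancel₀ _ hc0.ne').symm
  have h2 : ∑ j, (bl * Real.log (s.v j) + bu * Real.log (s.w j)) ≤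
      ∑ _i : Fin n, ∑ j, (Real.log (s.v j) + Real.log (s.w j)) / c := by
    simp only [Finset.sum_const, Finset.card_univ, Fintype.card_fin, nsmul_eq_mul,
      Finset.mul_sum]
    refine Finset.sum_le_sum fun j _ => ?_
    have e1 := mul_le_mul_of_nonneg_right ((le_div_iff₀ hc0).2 hbl)
      (Real.log_nonneg (hs.one_le_v j))
    have e2 := mul_le_mul_of_nonpos_right ((div_le_iff₀ hc0).2 hbu)
      (Real.log_nonpos (hs.w_pos j).le (hs.w_le_one j))
    calc bl * Real.log (s.v j) + bu * Real.log (s.w j)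
        ≤ n / c * Real.log (s.v j) + n / c * Real.log (s.w j) := add_le_add e1 e2
      _ = n * ((Real.log (s.v j) + Real.log (s.w j)) / c) := by ring
  have h3 : ∑ i, ∑ j, (Real.log (s.u i) / c + (Real.log (s.v j) + Real.log (s.w j)) / c -
      scaled K s.u s.v s.w i j) ≤ ∑ i, ∑ j, -(Real.log (K i j) / c) := by
    refine Finset.sum_le_sum fun i _ => Finset.sum_le_sum fun j _ => ?_
    have hx : 0 < scaled K s.u s.v s.w i j := by
      rw [scaled_apply]
      exact mul_pos (mul_pos (hs.u_pos i) (hK i j)) (hs.vw_pos j)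
    have e1 := Real.log_le_sub_one_of_pos hx
    have e2 : Real.log (scaled K s.u s.v s.w i j) / c ≤ scaled K s.u s.v s.w i j := by
      rw [div_le_iff₀ hc0]
      nlinarith
    have e3 : Real.log (scaled K s.u s.v s.w i j) =
        Real.log (s.u i) + Real.log (K i j) + (Real.log (s.v j) + Real.log (s.w j)) := by
      rw [scaled_apply, Real.log_mul (mul_pos (hs.u_pos i) (hK i j)).ne'
        (mul_pos (hs.v_pos j) (hs.w_pos j)).ne', Real.log_mul (hs.u_pos i).ne' (hK i j).ne',
        Real.log_mul (hs.v_pos j).ne' (hs.w_pos j).ne']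
    rw [e3, add_div, add_div] at e2
    linarith
  simp only [Finset.sum_add_distrib, Finset.sum_sub_distrib, Finset.sum_neg_distrib] at h3
  simp only [dualObjective, h1]
  simp only [Finset.sum_add_distrib] at h2 ⊢
  linarith

/-- The dual values increase and are bounded above, so their increments tend to `0`; these dominate
`(√r - 1) ^ 2` for the ratio `r` of successive entries of `u`. -/
lemma eventually_u_le_mul [NeZero n] [NeZero c] (hK : ∀ i j, 0 < K i j) (hbl : bl * c ≤ n)
    (hbu : (n : ℝ) ≤ bu * c) (hbu0 : 0 < bu) {s : ℕ → ScalingState n c}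
    (hs : ∀ k, (s k).Admissible) (hstep : ∀ k, s (k + 1) = sweep K bl bu (s k)) {t : ℝ}
    (ht : 1 < t) :
    ∀ᶠ k in atTop, ∀ i, (s k).u i ≤ t * (s (k + 1)).u i ∧ (s (k + 1)).u i ≤ t * (s k).u i := by
  set E : ℕ → ℝ := fun k => dualObjective K bl bu (s k).u (s k).v (s k).w with hE
  have hinc : ∀ k, E k + ∑ i, (Real.sqrt ((s k).u i / (s (k + 1)).u i) - 1) ^ 2 ≤ E (k + 1) := by
    intro k
    have := dualObjective_sweep (bl := bl) hK hbu0 (hs k)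
    rw [← hstep] at this
    exact this
  have hmono : Monotone E := monotone_nat_of_le_succ fun k =>
    (le_add_of_nonneg_right (Finset.sum_nonneg fun i _ => sq_nonneg _)).trans (hinc k)
  have hlim := tendsto_atTop_ciSup hmono
    ⟨_, Set.forall_mem_range.2 fun k => dualObjective_le hK hbl hbu (hs k)⟩
  have hdiff : Tendsto (fun k => E (k + 1) - E k) atTop (𝓝 0) := by
    simpa using ((tendsto_add_atTop_iff_nat 1).2 hlim).sub hlim
  have hr : Tendsto (fun k i => (s k).u i / (s (k + 1)).u i) atTop (𝓝 (1 : Fin n → ℝ)) := by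
    refine tendsto_pi_nhds.2 fun i => ?_
    have h1 : Tendsto (fun k => (Real.sqrt ((s k).u i / (s (k + 1)).u i) - 1) ^ 2) atTop
        (𝓝 0) := by
      refine squeeze_zero (fun k => sq_nonneg _) (fun k => ?_) hdiff
      have := Finset.single_le_sum
        (f := fun i => (Real.sqrt ((s k).u i / (s (k + 1)).u i) - 1) ^ 2)
        (fun i _ => sq_nonneg _) (Finset.mem_univ i)
      have := hinc k
      linarith
    have h2 : Tendsto (fun k => Real.sqrt ((s k).u i / (s (k + 1)).u i) - 1) atTop (𝓝 0) :=
      (tendsto_zero_iff_abs_tendsto_zero _).2 (by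
        simpa [Function.comp_def, Real.sqrt_sq_eq_abs] using h1.sqrt)
    have h3 := (h2.add_const 1).pow 2
    simp only [sub_add_cancel, zero_add, one_pow] at h3
    refine h3.congr fun k => ?_
    exact Real.sq_sqrt (div_pos ((hs k).u_pos i) ((hs (k + 1)).u_pos i)).le
  filter_upwards [eventually_mul_le_of_tendsto hr (fun _ => one_pos) ht] with k hk i
  have hpos := (hs (k + 1)).u_pos i
  obtain ⟨e1, e2⟩ := hk i
  rw [Pi.one_apply, mul_one, div_le_iff₀ hpos] at e1
  rw [Pi.one_apply, ← mul_div_assoc, one_le_div hpos] at e2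
  exact ⟨e1, e2⟩

end

/-! ### The column updates at a single index -/

section

variable {bl bu a w : ℝ}

/-- If `w = 1` and the new `v` exceeds `1`, the column sum after the lower update is `bl < bu`, so
the upper update is inactive. Thus complementarity with the old `w` passes to the new one. -/
lemma upper_update_eq_one_or_lower_update_eq_one (ha : 0 < a) (hlt : bl < bu)
    (h : max (bl / (a * w)) 1 = 1 ∨ w = 1) :
    max (bl / (a * w)) 1 = 1 ∨ min (bu / (a * max (bl / (a * w)) 1)) 1 = 1 := by
  by_cases hv : max (bl / (a * w)) 1 = 1
  · exact Or.inl hv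
  · obtain rfl := h.resolve_left hv
    rw [mul_one] at *
    rw [max_eq_right_iff, not_le] at hv
    refine Or.inr ?_
    have hb : 0 < bl := ha.trans ((one_lt_div ha).1 hv)
    rw [max_eq_left hv.le, mul_div_cancel₀ _ ha.ne']
    exact min_eq_right ((one_le_div hb).2 hlt.le)

lemma mul_updates_eq (ha : 0 < a) :
    max (bl / (a * w)) 1 * min (bu / (a * max (bl / (a * w)) 1)) 1 =
      min (bu / a) (max (bl / (a * w)) 1) := by
  have hv : 0 < max (bl / (a * w)) 1 := lt_max_of_lt_right one_pos
  rw [mul_min_of_nonneg _ _ hv.le, mul_one]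
  congr 1
  field_simp

lemma mul_updates_eq_clip (ha : 0 < a) (hw0 : 0 < w) (hw : w ≤ 1)
    (h : bl = bu ∨ max (bl / (a * w)) 1 = 1 ∨ w = 1) :
    max (bl / (a * w)) 1 * min (bu / (a * max (bl / (a * w)) 1)) 1 =
      min (max (bl / a) 1) (bu / a) := by
  rw [mul_updates_eq ha, min_comm]
  have hle : 0 ≤ bl → bl / a ≤ bl / (a * w) := fun hb =>
    div_le_div_of_nonneg_left hb (mul_pos ha hw0) (mul_le_of_le_one_right ha.le hw)
  rcases h with rfl | h | rfl
  · rcases le_total 0 bl with hb | hb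
    · rw [min_eq_right (le_max_of_le_left (hle hb)), min_eq_right (le_max_left _ _)]
    · rw [max_eq_right ((div_nonpos_of_nonpos_of_nonneg hb (mul_pos ha hw0).le).trans
        zero_le_one), max_eq_right ((div_nonpos_of_nonpos_of_nonneg hb ha.le).trans zero_le_one)]
  · rw [h]
    rw [max_eq_right_iff] at h
    rw [max_eq_right]
    rcases le_total 0 bl with hb | hb
    · exact (hle hb).trans h
    · exact (div_nonpos_of_nonpos_of_nonneg hb ha.le).trans zero_le_one
  · rw [mul_one]

lemma upper_update_eq (ha : 0 < a) (hw0 : 0 < w) (hbl : 0 < bl)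
    (hbu : 0 ≤ bu) :
    min (bu / (a * max (bl / (a * w)) 1)) 1 = min (min (bu / bl * w) (bu / a)) 1 := by
  congr 1
  rcases le_total (a * w) bl with h | h
  · rw [max_eq_left ((one_le_div (mul_pos ha hw0)).2 h), min_eq_left]
    · field_simp
    · rw [div_mul_eq_mul_div, div_le_div_iff₀ hbl ha]
      nlinarith
  · rw [max_eq_right ((div_le_one (mul_pos ha hw0)).2 h), min_eq_right, mul_one]
    rw [div_mul_eq_mul_div, div_le_div_iff₀ ha hbl]
    nlinarith

end

/-! ### Convergence of the iteration -/

section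

variable {n c : ℕ} {K : Matrix (Fin n) (Fin c) ℝ} {bl bu : ℝ}

lemma sweep_v_apply (s : ScalingState n c) (j : Fin c) :
    (sweep K bl bu s).v j = max (bl / ((Kᵀ *ᵥ (sweep K bl bu s).u) j * s.w j)) 1 := rfl

lemma sweep_w_apply (s : ScalingState n c) (j : Fin c) :
    (sweep K bl bu s).w j = min (bu / ((Kᵀ *ᵥ (sweep K bl bu s).u) j *
      max (bl / ((Kᵀ *ᵥ (sweep K bl bu s).u) j * s.w j)) 1)) 1 := rfl

/-- The assumptions on an orbit of the iteration, started from an admissible state. -/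
structure IsAdmissibleOrbit {n c : ℕ} (K : Matrix (Fin n) (Fin c) ℝ) (bl bu : ℝ)
    (s : ℕ → ScalingState n c) : Prop where
  kernel_pos : ∀ i j, 0 < K i j
  lower_le : bl * c ≤ n
  le_upper : (n : ℝ) ≤ bu * c
  upper_pos : 0 < bu
  lower_le_upper : bl ≤ bu
  admissible : ∀ k, (s k).Admissible
  step : ∀ k, s (k + 1) = sweep K bl bu (s k)

namespace IsAdmissibleOrbit

variable {s : ℕ → ScalingState n c}

lemma eventually_col_le_mul [NeZero n] [NeZero c] (h : IsAdmissibleOrbit K bl bu s) {t : ℝ}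
    (ht : 1 < t) : ∀ᶠ k in atTop, ∀ j, (Kᵀ *ᵥ (s k).u) j ≤ t * (Kᵀ *ᵥ (s (k + 1)).u) j ∧
      (Kᵀ *ᵥ (s (k + 1)).u) j ≤ t * (Kᵀ *ᵥ (s k).u) j := by
  filter_upwards [eventually_u_le_mul h.kernel_pos h.lower_le h.le_upper h.upper_pos
    h.admissible h.step ht] with k hk j
  exact ⟨mulVec_le_mul_mulVec (fun j i => h.kernel_pos i j) (fun i => (hk i).1) j,
    mulVec_le_mul_mulVec (fun j i => h.kernel_pos i j) (fun i => (hk i).2) j⟩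

/-- If `bl < bu`, then eventually the lower update is active only where the previous upper
scaling is inactive. -/
lemma eventually_v_eq_one_or_w_eq_one [NeZero n] [NeZero c] (h : IsAdmissibleOrbit K bl bu s)
    (hlt : bl < bu) : ∀ᶠ k in atTop, ∀ j, (s (k + 1)).v j = 1 ∨ (s k).w j = 1 := by
  have ha : ∀ k j, 0 < (Kᵀ *ᵥ (s k).u) j := fun k j =>
    colScale_pos h.kernel_pos (h.admissible k).u_pos j
  refine eventually_all.2 fun j => ?_
  have hv : ∀ k, (s (k + 1)).v j = max (bl / ((Kᵀ *ᵥ (s (k + 1)).u) j * (s k).w j)) 1 := by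
    intro k
    rw [h.step, sweep_v_apply]
  rcases le_or_gt bl 0 with hbl | hbl
  · refine Eventually.of_forall fun k => Or.inl ?_
    rw [hv, max_eq_right]
    exact (div_nonpos_of_nonpos_of_nonneg hbl
      (mul_pos (ha _ j) ((h.admissible k).w_pos j)).le).trans zero_le_one
  have hw : ∀ k, (s (k + 1)).w j =
      min (min (bu / bl * (s k).w j) (bu / (Kᵀ *ᵥ (s (k + 1)).u) j)) 1 := by
    intro k
    rw [← upper_update_eq (ha (k + 1) j) ((h.admissible k).w_pos j) hbl h.upper_pos.le,
      h.step, sweep_w_apply]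
  have hbad : ∀ k, ¬ ((s (k + 1)).v j = 1 ∨ (s k).w j = 1) ↔
      (Kᵀ *ᵥ (s (k + 1)).u) j * (s k).w j < bl ∧ (s k).w j < 1 := by
    intro k
    rw [not_or, hv, max_eq_right_iff, not_le,
      one_lt_div (mul_pos (ha _ j) ((h.admissible k).w_pos j)),
      ((h.admissible k).w_le_one j).lt_iff_ne]
  have hρ : 1 < bu / bl := (one_lt_div hbl).2 hlt
  obtain ⟨N, hN⟩ := eventually_atTop.1 (h.eventually_col_le_mul hρ)
  -- Failure propagates backwards. The value `bu / a` for the new `w` would put the next column sum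
  -- above `bl`, as `a` changes by at most the factor `bu / bl`; so `w` was multiplied by exactly
  -- `bu / bl`, and the previous step failed too.
  have hback : ∀ k, N ≤ k → ¬ ((s (k + 2)).v j = 1 ∨ (s (k + 1)).w j = 1) →
      (s (k + 1)).w j = bu / bl * (s k).w j ∧ ¬ ((s (k + 1)).v j = 1 ∨ (s k).w j = 1) := by
    intro k hk hb
    rw [hbad (k + 1)] at hb
    obtain ⟨hb1, hb2⟩ := hb
    have ha1 := ha (k + 1) j
    have hak := (hN (k + 1) (by omega) j).1
    rw [div_mul_eq_mul_div, le_div_iff₀ hbl] at hak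
    have hw1 : (s (k + 1)).w j = min (bu / bl * (s k).w j) (bu / (Kᵀ *ᵥ (s (k + 1)).u) j) := by
      rw [hw] at hb2 ⊢
      exact min_eq_left (by_contra fun hcon => by
        rw [min_eq_right (not_le.1 hcon).le] at hb2
        exact lt_irrefl _ hb2)
    have hne : ¬ bu / (Kᵀ *ᵥ (s (k + 1)).u) j ≤ bu / bl * (s k).w j := by
      intro hle
      rw [min_eq_right hle] at hw1
      rw [hw1, ← mul_div_assoc, div_lt_iff₀ ha1] at hb1
      linarith
    rw [not_le] at hne
    rw [min_eq_left hne.le] at hw1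
    refine ⟨hw1, (hbad k).2 ⟨?_, ?_⟩⟩
    · rw [lt_div_iff₀ ha1, div_mul_eq_mul_div, div_mul_eq_mul_div, div_lt_iff₀ hbl, mul_assoc]
        at hne
      rw [mul_comm]
      exact lt_of_mul_lt_mul_left hne h.upper_pos.le
    · have := (h.admissible k).w_pos j
      nlinarith
  -- Perpetual failure would make `w` grow geometrically, against `w ≤ 1`.
  obtain ⟨k, hkN, hk⟩ : ∃ k, N ≤ k ∧ ((s (k + 1)).v j = 1 ∨ (s k).w j = 1) := by
    by_contra! hcon
    have hcon' : ∀ k, N ≤ k → ¬ ((s (k + 1)).v j = 1 ∨ (s k).w j = 1) := fun k hk =>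
      not_or.2 (hcon k hk)
    have hpow : ∀ m : ℕ, (s (N + m)).w j = (bu / bl) ^ m * (s N).w j := by
      intro m
      induction m with
      | zero => simp
      | succ m ih =>
        rw [← add_assoc, (hback (N + m) (by omega) (hcon' (N + m + 1) (by omega))).1, ih]
        ring
    obtain ⟨m, hm⟩ := pow_unbounded_of_one_lt ((s N).w j)⁻¹ hρ
    have hpos := (h.admissible N).w_pos j
    rw [inv_lt_iff_one_lt_mul₀ hpos, ← hpow] at hm
    exact hm.not_ge ((h.admissible _).w_le_one j)
  refine eventually_atTop.2 ⟨k, fun l hl => ?_⟩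
  induction l, hl using Nat.le_induction with
  | base => exact hk
  | succ l hl ih => exact by_contra fun hb => (hback l (hkN.trans hl) hb).2 ih

lemma eventually_eq_reducedStep [NeZero n] [NeZero c] (h : IsAdmissibleOrbit K bl bu s) :
    ∀ᶠ k in atTop, (s (k + 1)).v * (s (k + 1)).w = reducedStep K bl bu ((s k).v * (s k).w) := by
  have key : ∀ᶠ k in atTop, ∀ j, bl = bu ∨ (s (k + 1)).v j = 1 ∨ (s k).w j = 1 := by
    rcases h.lower_le_upper.eq_or_lt with heq | hlt
    · exact Eventually.of_forall fun _ _ => Or.inl heq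
    · exact (h.eventually_v_eq_one_or_w_eq_one hlt).mono fun k hk j => Or.inr (hk j)
  filter_upwards [key] with k hk
  funext j
  have hj := hk j
  rw [h.step, sweep_v_apply] at hj
  rw [h.step, Pi.mul_apply, sweep_v_apply, sweep_w_apply]
  have ha := colScale_pos h.kernel_pos (h.admissible (k + 1)).u_pos j
  rw [h.step] at ha
  exact mul_updates_eq_clip ha ((h.admissible k).w_pos j) ((h.admissible k).w_le_one j) hj

lemma exists_tendsto_vw [NeZero n] [NeZero c] (h : IsAdmissibleOrbit K bl bu s) :
    ∃ z : Fin c → ℝ, (∀ j, 0 < z j) ∧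
      Tendsto (fun k => (s k).v * (s k).w) atTop (𝓝 z) := by
  obtain ⟨N, hN⟩ := eventually_atTop.1 h.eventually_eq_reducedStep
  set z : ℕ → Fin c → ℝ := fun k => (s (k + N)).v * (s (k + N)).w with hzdef
  have hz : ∀ k, z (k + 1) = reducedStep K bl bu (z k) := by
    intro k
    simp only [hzdef]
    rw [add_right_comm]
    exact hN (k + N) (by omega)
  obtain ⟨m, M, hm, hb⟩ := exists_bounds_reducedStep h.kernel_pos h.lower_le h.le_upper
    (fun j => (h.admissible (0 + N)).vw_pos j) hz
  have hreg : ∀ t : ℝ, 1 < t → ∀ᶠ k in atTop, ∀ j, z (k + 1) j ≤ t * z k j ∧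
      z k j ≤ t * z (k + 1) j := by
    intro t ht
    obtain ⟨L, hL⟩ := eventually_atTop.1 (h.eventually_col_le_mul ht)
    -- The index must be at least `1` so that `z k` is itself an output of the clip; closeness of
    -- the column sums then passes to `z`.
    refine eventually_atTop.2 ⟨L + 1, fun k hk j => ?_⟩
    obtain ⟨l, rfl⟩ : ∃ l, k = l + 1 := ⟨k - 1, by omega⟩
    have hclip : ∀ l, z (l + 1) j = min (max (bl / (Kᵀ *ᵥ (s (l + N + 1)).u) j) 1)
        (bu / (Kᵀ *ᵥ (s (l + N + 1)).u) j) := by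
      intro l
      rw [hz, h.step]
      rfl
    have ha : ∀ k, 0 < (Kᵀ *ᵥ (s k).u) j := fun k =>
      colScale_pos h.kernel_pos (h.admissible k).u_pos j
    obtain ⟨h1, h2⟩ := hL (l + N + 1) (by omega) j
    rw [hclip (l + 1), hclip l, add_right_comm l 1 N]
    exact ⟨clip_le_mul (ha _) (ha _) ht.le h.upper_pos.le h1,
      clip_le_mul (ha _) (ha _) ht.le h.upper_pos.le h2⟩
  obtain ⟨x, hx, hlim⟩ := exists_tendsto_of_thompson_nonexpansive
    (T := reducedStep K bl bu)
    (fun x y hx hy t ht hxy j => reducedStep_le_mul h.kernel_pos h.upper_pos.le hx hy ht hxy j)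
    (fun x hx => continuousAt_reducedStep h.kernel_pos bl bu hx) hz hm hb hreg
  exact ⟨x, hx, (tendsto_add_atTop_iff_nat N).1 hlim⟩

lemma tendsto_u [NeZero n] [NeZero c] (h : IsAdmissibleOrbit K bl bu s) {z : Fin c → ℝ}
    (hz : ∀ j, 0 < z j) (hlim : Tendsto (fun k => (s k).v * (s k).w) atTop (𝓝 z)) :
    Tendsto (fun k => (s k).u) atTop (𝓝 (rowScale K z)) := by
  rw [← tendsto_add_atTop_iff_nat 1]
  refine ((continuousAt_rowScale h.kernel_pos hz).tendsto.comp hlim).congr fun k => ?_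
  rw [h.step]
  rfl

lemma exists_tendsto_v_w [NeZero n] [NeZero c] (h : IsAdmissibleOrbit K bl bu s) :
    ∃ v w : Fin c → ℝ, (∀ j, 0 < w j) ∧ Tendsto (fun k => (s k).v) atTop (𝓝 v) ∧
      Tendsto (fun k => (s k).w) atTop (𝓝 w) := by
  obtain ⟨z, hz, hlim⟩ := h.exists_tendsto_vw
  have ha : ∀ k j, 0 < (Kᵀ *ᵥ (s k).u) j := fun k j =>
    colScale_pos h.kernel_pos (h.admissible k).u_pos j
  rcases h.lower_le_upper.eq_or_lt with heq | hlt
  · have hw : ∀ j, ∃ w, 0 < w ∧ Tendsto (fun k => (s k).w j) atTop (𝓝 w) := by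
      intro j
      -- With `bl = bu` the new product is `bu / a`, and the recursion for `w` is a running minimum
      -- against it.
      have hstep : ∀ k, (s (k + 1)).w j = min ((s k).w j) (((s (k + 1)).v * (s (k + 1)).w) j) := by
        intro k
        have hb : 0 < bl := heq ▸ h.upper_pos
        have e1 := upper_update_eq (ha (k + 1) j) ((h.admissible k).w_pos j) hb h.upper_pos.le
        have e2 := mul_updates_eq_clip (bu := bu) (ha (k + 1) j) ((h.admissible k).w_pos j)
          ((h.admissible k).w_le_one j) (Or.inl heq)
        have e3 := (h.admissible k).w_le_one j
        rw [Pi.mul_apply]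
        rw [h.step] at e1 e2 ⊢
        rw [sweep_v_apply, sweep_w_apply, e2, e1, ← heq, div_self hb.ne', one_mul,
          min_eq_right (le_max_left _ _), min_eq_left (min_le_of_left_le e3)]
      have hanti : Antitone fun k => (s k).w j := antitone_nat_of_succ_le fun k => by
        rw [hstep]
        exact min_le_left _ _
      obtain ⟨N, hN⟩ := eventually_atTop.1
        ((tendsto_pi_nhds.1 hlim j).eventually_const_lt (half_lt_self (hz j)))
      -- Since the products eventually exceed `z j / 2`, the running minimum stays above `η`, so its
      -- limit is positive and `z / w` makes sense.
      set η := min ((s N).w j) (z j / 2) with hη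
      have hη0 : 0 < η := lt_min ((h.admissible N).w_pos j) (half_pos (hz j))
      have hlow : ∀ k, N ≤ k → η ≤ (s k).w j := by
        intro k hk
        induction k, hk using Nat.le_induction with
        | base => exact min_le_left _ _
        | succ k hk ih =>
          rw [hstep]
          exact le_min ih ((min_le_right _ _).trans (hN (k + 1) (by omega)).le)
      have hconv := tendsto_atTop_ciInf hanti
        ⟨0, Set.forall_mem_range.2 fun k => ((h.admissible k).w_pos j).le⟩
      exact ⟨_, hη0.trans_le (ge_of_tendsto hconv (eventually_atTop.2 ⟨N, hlow⟩)), hconv⟩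
    choose w hw0 hwlim using hw
    refine ⟨fun j => z j / w j, w, hw0, tendsto_pi_nhds.2 fun j => ?_, tendsto_pi_nhds.2 hwlim⟩
    refine ((tendsto_pi_nhds.1 hlim j).div (hwlim j) (hw0 j).ne').congr fun k => ?_
    exact mul_div_cancel_right₀ _ ((h.admissible k).w_pos j).ne'
  · have hev : ∀ᶠ k in atTop, ∀ j, (s (k + 1)).v j = 1 ∨ (s (k + 1)).w j = 1 := by
      filter_upwards [h.eventually_v_eq_one_or_w_eq_one hlt] with k hk j
      have hj := hk j
      have := ha (k + 1) j
      rw [h.step] at hj this ⊢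
      rw [sweep_v_apply] at hj ⊢
      rw [sweep_w_apply]
      exact upper_update_eq_one_or_lower_update_eq_one this hlt hj
    have hlim' := (tendsto_add_atTop_iff_nat 1).2 hlim
    -- With `w ≤ 1 ≤ v` and one factor equal to `1`, the product determines both.
    refine ⟨fun j => max (z j) 1, fun j => min (z j) 1, fun j => lt_min (hz j) one_pos,
      ?_, ?_⟩
    · rw [← tendsto_add_atTop_iff_nat 1]
      refine tendsto_pi_nhds.2 fun j => ?_
      refine ((tendsto_pi_nhds.1 hlim' j).max tendsto_const_nhds).congr' ?_
      filter_upwards [hev] with k hk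
      have h1 := (h.admissible (k + 1)).one_le_v j
      have h2 := (h.admissible (k + 1)).w_le_one j
      rcases hk j with e | e
      · simp [e, h2]
      · simp [e, h1]
    · rw [← tendsto_add_atTop_iff_nat 1]
      refine tendsto_pi_nhds.2 fun j => ?_
      refine ((tendsto_pi_nhds.1 hlim' j).min tendsto_const_nhds).congr' ?_
      filter_upwards [hev] with k hk
      have h1 := (h.admissible (k + 1)).one_le_v j
      have h2 := (h.admissible (k + 1)).w_le_one j
      rcases hk j with e | e
      · simp [e, h2]
      · simp [e, h1]

/-- The limits exist and are a fixed point of the iteration. -/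
lemma exists_tendsto [NeZero n] [NeZero c] (h : IsAdmissibleOrbit K bl bu s) :
    ∃ (u : Fin n → ℝ) (v w : Fin c → ℝ), Tendsto (fun k => (s k).u) atTop (𝓝 u) ∧
      Tendsto (fun k => (s k).v) atTop (𝓝 v) ∧ Tendsto (fun k => (s k).w) atTop (𝓝 w) ∧
      (⟨u, v, w⟩ : ScalingState n c).Admissible ∧
      sweep K bl bu ⟨u, v, w⟩ = ⟨u, v, w⟩ := by
  obtain ⟨v, w, hw, hvlim, hwlim⟩ := h.exists_tendsto_v_w
  have hv : ∀ j, 1 ≤ v j := fun j => ge_of_tendsto' (tendsto_pi_nhds.1 hvlim j) fun k =>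
    (h.admissible k).one_le_v j
  have hv0 : ∀ j, 0 < v j := fun j => one_pos.trans_le (hv j)
  have hw1 : ∀ j, w j ≤ 1 := fun j => le_of_tendsto' (tendsto_pi_nhds.1 hwlim j) fun k =>
    (h.admissible k).w_le_one j
  have hz : ∀ j, 0 < (v * w) j := fun j => mul_pos (hv0 j) (hw j)
  have hulim := h.tendsto_u hz (hvlim.mul hwlim)
  have hupos := rowScale_pos h.kernel_pos hz
  refine ⟨_, v, w, hulim, hvlim, hwlim, ⟨hupos, hv, hw, hw1⟩, ?_⟩
  have ha := colScale_pos h.kernel_pos hupos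
  have halim : ∀ j, Tendsto (fun k => (Kᵀ *ᵥ (s (k + 1)).u) j) atTop
      (𝓝 ((Kᵀ *ᵥ rowScale K (v * w)) j)) := fun j =>
    (((continuous_apply j).comp (Continuous.matrix_mulVec continuous_const continuous_id)
      ).tendsto _).comp ((tendsto_add_atTop_iff_nat 1).2 hulim)
  have hveq : updateV K bl (rowScale K (v * w)) w = v := by
    funext j
    refine tendsto_nhds_unique ?_ (tendsto_pi_nhds.1 ((tendsto_add_atTop_iff_nat 1).2 hvlim) j)
    refine ((tendsto_const_nhds.div ((halim j).mul (tendsto_pi_nhds.1 hwlim j))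
      (mul_pos (ha j) (hw j)).ne').max tendsto_const_nhds).congr fun k => ?_
    rw [Pi.div_apply, h.step]
    rfl
  have hweq : updateW K bu (rowScale K (v * w)) v = w := by
    funext j
    refine tendsto_nhds_unique ?_ (tendsto_pi_nhds.1 ((tendsto_add_atTop_iff_nat 1).2 hwlim) j)
    refine ((tendsto_const_nhds.div ((halim j).mul (tendsto_pi_nhds.1
      ((tendsto_add_atTop_iff_nat 1).2 hvlim) j))
      (mul_pos (ha j) (hv0 j)).ne').min tendsto_const_nhds).congr fun k => ?_
    rw [Pi.div_apply, h.step]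
    rfl
  ext1
  · rfl
  · exact hveq
  · change updateW K bu (rowScale K (v * w)) (updateV K bl (rowScale K (v * w)) w) = w
    rw [hveq, hweq]

end IsAdmissibleOrbit

/-- Fixed points of the iteration satisfy the optimality conditions. -/
lemma kkt_of_sweep_eq [NeZero n] [NeZero c] (hK : ∀ i j, 0 < K i j) {s : ScalingState n c}
    (hs : s.Admissible) (hfix : sweep K bl bu s = s) :
    scaled K s.u s.v s.w ∈ Omega n c bl bu ∧
      (∀ j, 1 < s.v j → ∑ i, scaled K s.u s.v s.w i j = bl) ∧
      ∀ j, s.w j < 1 → ∑ i, scaled K s.u s.v s.w i j = bu := by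
  have hu : ∀ i, s.u i = 1 / (K *ᵥ (s.v * s.w)) i := fun i =>
    congrFun (congrArg ScalingState.u hfix).symm i
  have hv : ∀ j, s.v j = max (bl / ((Kᵀ *ᵥ s.u) j * s.w j)) 1 := fun j => by
    have := sweep_v_apply (K := K) (bl := bl) (bu := bu) s j
    rwa [hfix] at this
  have hw : ∀ j, s.w j = min (bu / ((Kᵀ *ᵥ s.u) j * s.v j)) 1 := fun j => by
    have := sweep_w_apply (K := K) (bl := bl) (bu := bu) s j
    rwa [hfix, ← hv] at this
  have ha := colScale_pos hK hs.u_pos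
  have haw : ∀ j, 0 < (Kᵀ *ᵥ s.u) j * s.w j := fun j => mul_pos (ha j) (hs.w_pos j)
  have hav : ∀ j, 0 < (Kᵀ *ᵥ s.u) j * s.v j := fun j => mul_pos (ha j) (hs.v_pos j)
  have hcolv : ∀ j, ∑ i, scaled K s.u s.v s.w i j = s.v j * ((Kᵀ *ᵥ s.u) j * s.w j) :=
    fun j => by rw [sum_scaled_col]; ring
  have hcolw : ∀ j, ∑ i, scaled K s.u s.v s.w i j = s.w j * ((Kᵀ *ᵥ s.u) j * s.v j) :=
    fun j => by rw [sum_scaled_col]; ring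
  refine ⟨⟨fun i => ?_, fun j => ⟨?_, ?_⟩, fun i j => ?_⟩, fun j hj => ?_, fun j hj => ?_⟩
  · rw [sum_scaled_row, hu]
    exact one_div_mul_cancel (mulVec_pos hK hs.vw_pos i).ne'
  · rw [hcolv, ← div_le_iff₀ (haw j)]
    exact (le_max_left _ _).trans_eq (hv j).symm
  · rw [hcolw, ← le_div_iff₀ (hav j)]
    exact (hw j).trans_le (min_le_left _ _)
  · rw [scaled_apply]
    exact (mul_pos (mul_pos (hs.u_pos i) (hK i j)) (hs.vw_pos j)).le
  · have : s.v j = bl / ((Kᵀ *ᵥ s.u) j * s.w j) := by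
      rcases max_choice (bl / ((Kᵀ *ᵥ s.u) j * s.w j)) 1 with e | e
      · rw [hv, e]
      · rw [← hv] at e
        exact absurd e hj.ne'
    rw [hcolv, this, div_mul_cancel₀ _ (haw j).ne']
  · have : s.w j = bu / ((Kᵀ *ᵥ s.u) j * s.v j) := by
      rcases min_choice (bu / ((Kᵀ *ᵥ s.u) j * s.v j)) 1 with e | e
      · rw [← hw] at e
        exact e
      · rw [← hw] at e
        exact absurd e hj.ne
    rw [hcolw, this, div_mul_cancel₀ _ (hav j).ne']

/-- The total mass `n` is the sum of `c` column sums, each in `[bl, bu]`. -/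
lemma bounds_of_nonempty_Omega (h : (Omega n c bl bu).Nonempty) :
    bl * c ≤ n ∧ (n : ℝ) ≤ bu * c := by
  obtain ⟨X, hrow, hcol, -⟩ := h
  have hsum : ∑ j, ∑ i, X i j = n := by
    rw [Finset.sum_comm]
    simp [hrow]
  constructor
  · rw [← hsum]
    simpa [mul_comm] using Finset.sum_le_sum fun j (_ : j ∈ Finset.univ) => (hcol j).1
  · rw [← hsum]
    simpa [mul_comm] using Finset.sum_le_sum fun j (_ : j ∈ Finset.univ) => (hcol j).2

end

end DualBoundedOT

theorem theorem4p5 (n c : ℕ) (hn : 0 < n) (bl bu δ : ℝ) (hδ : 0 < δ)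
    (gradH : Matrix (Fin n) (Fin c) ℝ)
    (hΩ : (DualBoundedOT.Omega n c bl bu).Nonempty) :
    ∃ X : Matrix (Fin n) (Fin c) ℝ,
      -- `X` is the unique optimal solution of the regularized problem
      DualBoundedOT.IsOptimal bl bu gradH δ X ∧
      (∀ Y, DualBoundedOT.IsOptimal bl bu gradH δ Y → Y = X) ∧
      -- from every positive start the iteration converges to vectors that scale to `X`
      ∀ s₀ : DualBoundedOT.ScalingState n c, (∀ j, 0 < s₀.v j) → (∀ j, 0 < s₀.w j) →
        ∃ (u : Fin n → ℝ) (v w : Fin c → ℝ),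
          Tendsto (fun k =>
            (DualBoundedOT.iter (DualBoundedOT.gibbsKernel gradH δ) bl bu s₀ k).u)
            atTop (𝓝 u) ∧
          Tendsto (fun k =>
            (DualBoundedOT.iter (DualBoundedOT.gibbsKernel gradH δ) bl bu s₀ k).v)
            atTop (𝓝 v) ∧
          Tendsto (fun k =>
            (DualBoundedOT.iter (DualBoundedOT.gibbsKernel gradH δ) bl bu s₀ k).w)
            atTop (𝓝 w) ∧
          X = DualBoundedOT.scaled (DualBoundedOT.gibbsKernel gradH δ) u v w ∧
          (∀ i, 0 < u i) ∧ (∀ j, 1 ≤ v j) ∧ (∀ j, 0 < w j ∧ w j ≤ 1) ∧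
          -- `v` and `w` differ from `1` only where the corresponding column bound is attained
          (∀ j, 1 < v j → ∑ i, X i j = bl) ∧
          (∀ j, w j < 1 → ∑ i, X i j = bu) := by
  open DualBoundedOT in
  have hK := gibbsKernel_pos gradH δ
  set K := gibbsKernel gradH δ with hKdef
  obtain ⟨hbl, hbu⟩ := bounds_of_nonempty_Omega hΩ
  have hn' : (0 : ℝ) < n := by exact_mod_cast hn
  have hc : c ≠ 0 := by
    rintro rfl
    simp only [Nat.cast_zero, mul_zero] at hbu
    exact hbu.not_gt hn'
  have : NeZero n := ⟨hn.ne'⟩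
  have : NeZero c := ⟨hc⟩
  have hc' : (0 : ℝ) < c := by exact_mod_cast Nat.pos_of_ne_zero hc
  have hbu0 : 0 < bu := pos_of_mul_pos_left (hn'.trans_le hbu) hc'.le
  have hle : bl ≤ bu := le_of_mul_le_mul_right (hbl.trans hbu) hc'
  have main : ∀ s₀ : ScalingState n c, (∀ j, 0 < s₀.v j) → (∀ j, 0 < s₀.w j) →
      ∃ (u : Fin n → ℝ) (v w : Fin c → ℝ),
        Tendsto (fun k => (iter K bl bu s₀ k).u) atTop (𝓝 u) ∧
        Tendsto (fun k => (iter K bl bu s₀ k).v) atTop (𝓝 v) ∧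
        Tendsto (fun k => (iter K bl bu s₀ k).w) atTop (𝓝 w) ∧
        (⟨u, v, w⟩ : ScalingState n c).Admissible ∧
        sweep K bl bu ⟨u, v, w⟩ = ⟨u, v, w⟩ := by
    intro s₀ hv hw
    have hstep : ∀ k, iter K bl bu s₀ (k + 1) = sweep K bl bu (iter K bl bu s₀ k) := fun k =>
      Function.iterate_succ_apply' _ _ _
    have hadm : ∀ k, (iter K bl bu s₀ (k + 1)).Admissible := by
      intro k
      induction k with
      | zero => exact admissible_sweep hK hbu0 hv hw
      | succ k ih =>
        rw [hstep]
        exact admissible_sweep hK hbu0 ih.v_pos ih.w_pos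
    -- The start only has positive `v` and `w`; the admissible bounds hold from the first sweep on,
    -- hence the shift by one.
    obtain ⟨u, v, w, h1, h2, h3, h4⟩ := IsAdmissibleOrbit.exists_tendsto
      (s := fun k => iter K bl bu s₀ (k + 1))
      ⟨hK, hbl, hbu, hbu0, hle, hadm, fun k => hstep (k + 1)⟩
    exact ⟨u, v, w, (tendsto_add_atTop_iff_nat 1).1 h1, (tendsto_add_atTop_iff_nat 1).1 h2,
      (tendsto_add_atTop_iff_nat 1).1 h3, h4⟩
  have hopt : ∀ {u : Fin n → ℝ} {v w : Fin c → ℝ}, (⟨u, v, w⟩ : ScalingState n c).Admissible →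
      sweep K bl bu ⟨u, v, w⟩ = ⟨u, v, w⟩ →
      scaled K u v w ∈ Omega n c bl bu ∧ ∀ Y ∈ Omega n c bl bu, Y ≠ scaled K u v w →
        regObjective gradH δ (scaled K u v w) < regObjective gradH δ Y := by
    intro u v w hadm hfix
    obtain ⟨hΩ', h1, h2⟩ := kkt_of_sweep_eq hK hadm hfix
    exact ⟨hΩ', fun Y hY hne => regObjective_lt_of_scaled gradH hδ hadm.u_pos hadm.one_le_v
      (fun j => ⟨hadm.w_pos j, hadm.w_le_one j⟩) rfl hΩ' h1 h2 hY hne⟩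
  -- The minimizer comes from one run of the iteration.
  obtain ⟨u, v, w, -, -, -, hadm, hfix⟩ := main ⟨1, 1, 1⟩ (fun _ => one_pos) (fun _ => one_pos)
  obtain ⟨hmem, hmin⟩ := hopt hadm hfix
  refine ⟨scaled K u v w, ⟨hmem, fun Y hY => ?_⟩, fun Y hY => ?_, fun s₀ hv hw => ?_⟩
  · rcases eq_or_ne Y (scaled K u v w) with rfl | hne
    · exact le_refl (regObjective gradH δ _)
    · exact (hmin Y hY hne).le
  · by_contra hne
    exact (hmin Y hY.1 hne).not_ge (hY.2 hmem)
  · obtain ⟨u', v', w', h1, h2, h3, hadm', hfix'⟩ := main s₀ hv hw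
    obtain ⟨hmem', hmin'⟩ := hopt hadm' hfix'
    -- Limits from different starts need not be compared as vectors: both matrices are strict
    -- minimizers, so they coincide.
    have heq : scaled K u v w = scaled K u' v' w' := by
      by_contra hne
      exact lt_asymm (hmin _ hmem' (Ne.symm hne)) (hmin' _ hmem hne)
    obtain ⟨-, k1, k2⟩ := kkt_of_sweep_eq hK hadm' hfix'
    rw [heq]
    exact ⟨u', v', w', h1, h2, h3, rfl, hadm'.u_pos, hadm'.one_le_v,
      fun j => ⟨hadm'.w_pos j, hadm'.w_le_one j⟩, k1, k2⟩
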